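/- Let $q\ge 0$ and $L\ge 1$ be integers. Consider a periodic chain of $2L$ particles, each with state space $\mathbb{C}^q$, located at the positions $x\in\tfrac12\mathbb{Z}/L\mathbb{Z}$. Let $U$ be an operator on $\mathbb{C}^q\otimes\mathbb{C}^q$ that is 2-unitary: $U$, its realignment $U^{R_1}$, $\langle\beta\alpha|U^{R_1}|ji\rangle=\langle i\alpha|U|j\beta\rangle$, and its partial transpose $U^{T_2}$, $\langle i\beta|U^{T_2}|j\alpha\rangle=\langle i\alpha|U|j\beta\rangle$, are all unitary. Let $\mathbf{E}=U^{\otimes L}$ be the layer of gates $U$ on the pairs of positions $(z,z+\tfrac12)$, $z$ an integer mod $L$; let $\mathbf{T}|k_1k_2\cdots k_{2L}\rangle=|k_2\cdots k_{2L}k_1\rangle$ be the site translation, $\mathbf{O}=\mathbf{T}U^{\otimes L}\mathbf{T}^\dagger$ the layer of gates on the pairs $(z-\tfrac12,z)$, and $\mathbf{U}=\mathbf{O}\mathbf{E}$ the evolution operator of the brickwork circuit over one unit of time. For an evolution operator $\mathbf{V}$ of the chain, operators $a,b,c,d$ on $\mathbb{C}^q$ and positions $x_1,x_2$ put $$C_{\mathbf{V}}(x_1,x_2)=\frac1{q^{2L}}\,\mathrm{tr}\!\left[c^{x_1}d^{x_2}\,\mathbf{V}^{-1}\,a^{0}\,b^{1/2}\,\mathbf{V}\right],$$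 where $a^x$ denotes $a$ acting at position $x$. Assume that $a\otimes b$ is traceless, i.e. $\mathrm{tr}\,a=0$ or $\mathrm{tr}\,b=0$ (in particular, all of $a,b,c,d$ may be traceless, as for the elements $a_i,a_j,a_k,a_l$, $i,j,k,l\neq0$, of an orthogonal operator basis with $a_0=\mathbb{1}$). Then, for all positions $x_1,x_2$ (inside, on and outside the light cone): 1. $C_{\mathbf{U}^t}(x_1,x_2)=0$ for every integer $t>0$ with $2t<L$; in particular, in the thermodynamic limit $L\to\infty$ the correlations vanish at all integer times $t>0$. 2. Let $\mathbf{W}_n=\mathbf{E}\mathbf{O}\mathbf{E}\cdots$ be the circuit of $n$ alternating layers (duration $t=n/2$) whose latest layer is $\mathbf{E}$, so that $a^0$ and $b^{1/2}$ are attached to the two legs of one and the same gate; for odd $n=2t$ this is the evolution $\mathbf{E}\,\mathbf{U}^{t-1/2}$ up to the half-integer time $t$. Then $C_{\mathbf{W}_n}(x_1,x_2)=0$ for every $n$ with $3\le n\le L$, i.e. for $t\ge 3/2$. 3. If $L\ge2$, then $C_{\mathbf{W}_2}(x_1,x_2)=0$ unless $\{x_1,x_2\}$ is $\{\tfrac12,1\}$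 or $\{-\tfrac12,0\}$. -/

import Mathlib

open Matrix

noncomputable section

namespace BernoulliCircuit

/-- Operators on two particles with local dimension `q`;
`U (i, α) (j, β)` is the matrix element `⟨i α| U |j β⟩`. -/
abbrev TwoBody (q : ℕ) := Matrix (Fin q × Fin q) (Fin q × Fin q) ℂ

/-- The realignment `U ^ R₁`: `⟨β α| U ^ R₁ |j i⟩ = ⟨i α| U |j β⟩`. -/
def realign {q : ℕ} (U : TwoBody q) : TwoBody q :=
  Matrix.of fun r c => U (c.2, r.2) (c.1, r.1)

/-- The partial transpose `U ^ T₂`: `⟨i β| U ^ T₂ |j α⟩ = ⟨i α| U |j β⟩`. -/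
def partialTranspose {q : ℕ} (U : TwoBody q) : TwoBody q :=
  Matrix.of fun r c => U (r.1, c.2) (c.1, r.2)

/-- `U` is dual-unitary: `U` and its realignment are unitary. -/
def IsDualUnitary {q : ℕ} (U : TwoBody q) : Prop :=
  U ∈ unitaryGroup (Fin q × Fin q) ℂ ∧ realign U ∈ unitaryGroup (Fin q × Fin q) ℂ

/-- `U` is T-dual: `U` and its partial transpose are unitary. -/
def IsTDual {q : ℕ} (U : TwoBody q) : Prop :=
  U ∈ unitaryGroup (Fin q × Fin q) ℂ ∧ partialTranspose U ∈ unitaryGroup (Fin q × Fin q) ℂ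

/-- `U` is 2-unitary: it is both dual-unitary and T-dual. -/
def IsTwoUnitary {q : ℕ} (U : TwoBody q) : Prop :=
  IsDualUnitary U ∧ IsTDual U

/-- Basis configurations of the periodic chain of `2 * L` particles. The site `s : ZMod (2 * L)`
sits at the position `s / 2` of the periodic lattice of half-integers with period `L`. -/
abbrev Config (q L : ℕ) := ZMod (2 * L) → Fin q

/-- Operators on the whole chain. -/
abbrev ChainOp (q L : ℕ) := Matrix (Config q L) (Config q L) ℂ

/-- The layer `U ^ ⊗ L`, with one gate on each pair of sites `(2 z, 2 z + 1)`,
that is, on the positions `(z, z + 1/2)`. -/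
def evenLayer {q : ℕ} (U : TwoBody q) (L : ℕ) : ChainOp q L :=
  Matrix.of fun σ τ => ∏ z : Fin L,
    U (σ (2 * ((z : ℕ) : ZMod (2 * L))), σ (2 * ((z : ℕ) : ZMod (2 * L)) + 1))
      (τ (2 * ((z : ℕ) : ZMod (2 * L))), τ (2 * ((z : ℕ) : ZMod (2 * L)) + 1))

/-- The site translation, mapping the basis vector `|k₁ k₂ … k_{2L}⟩` to `|k₂ … k_{2L} k₁⟩`. -/
def translation (q L : ℕ) [NeZero L] : ChainOp q L :=
  Matrix.of fun σ τ => if σ = fun s => τ (s + 1) then 1 else 0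

/-- The layer `T U ^ ⊗ L T†`, whose gates act on the positions `(z - 1/2, z)`. -/
def oddLayer {q : ℕ} (U : TwoBody q) (L : ℕ) [NeZero L] : ChainOp q L :=
  translation q L * evenLayer U L * (translation q L)ᴴ

/-- The evolution operator `T U ^ ⊗ L T† U ^ ⊗ L` over one unit of time. -/
def floquet {q : ℕ} (U : TwoBody q) (L : ℕ) [NeZero L] : ChainOp q L :=
  oddLayer U L * evenLayer U L

/-- The brickwork of `n` layers (each of them half a unit of time), alternately even and odd,
whose latest layer (the leftmost factor) is an even one: `1`, `E`, `E O`, `E O E`, … -/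
def brickwork {q : ℕ} (U : TwoBody q) (L : ℕ) [NeZero L] : ℕ → ChainOp q L
  | 0 => 1
  | n + 1 => brickwork U L n * (if Even n then evenLayer U L else oddLayer U L)

/-- The one-particle operator `a` acting on the site `x` of the chain. -/
def siteOp {q L : ℕ} [NeZero L] (x : ZMod (2 * L)) (a : Matrix (Fin q) (Fin q) ℂ) :
    ChainOp q L :=
  Matrix.of fun σ τ => if ∀ y, y ≠ x → σ y = τ y then a (σ x) (τ x) else 0

/-- The infinite-temperature correlation
`q ^ (-2L) * tr (c ^ x₁ d ^ x₂ V⁻¹ a ^ 0 b ^ (1/2) V)` of two-site product observables under the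
evolution operator `V`; the positions `0` and `1/2` are the sites `0` and `1`. -/
def corr {q L : ℕ} [NeZero L] (V : ChainOp q L) (a b c d : Matrix (Fin q) (Fin q) ℂ)
    (x₁ x₂ : ZMod (2 * L)) : ℂ :=
  1 / (q : ℂ) ^ (2 * L) *
    (siteOp x₁ c * siteOp x₂ d * V⁻¹ * siteOp 0 a * siteOp 1 b * V).trace

end BernoulliCircuit

end

/-!
The proof follows the observable `a ⊗ b` in the Heisenberg picture. For a 2-unitary gate `U`,
conjugation `x ↦ U† x U` takes an operator that is traceless on one leg and trivial on the other to
an operator whose partial traces over either leg vanish (`conj_mem_of_left`, `conj_mem_of_right`):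
one of the two partial traces is computed by the unitarity of the realignment, the other one by the
unitarity of the partial transpose. Hence an operator supported on an arc of the chain and traceless
at both ends of it grows, with each layer, by one site at each end, and becomes traceless at the
last two sites of both ends (`Spread.step`). While the two ends have not met around the chain, this
gives more than two sites at which the evolved operator is traceless, whereas `c` and `d` act on two
sites only; the operator has zero overlap with every operator that is trivial at one of its traceless
sites (`trace_piTensor_mul_eq_zero`), so the correlation vanishes.

An operator on the sites `0` and `1` with zero trace splits into a part that is traceless at both
sites and parts living on one site (`JointlyTraceless.exists_decomposition`). A one-site part needs
one layer to become an arc with two ends; this is why the correlations can survive one odd layer, on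
the two legs of a single gate. The circuit that ends with an even layer begins, in the Heisenberg
picture, by conjugating with the gate on `(0, 1)`, which preserves the support and the vanishing
trace; all three claims thus reduce to the evolution that starts with an odd layer.

Everything is local: `LocIn W s X` expresses that `X` lies in `W` at the site `s`, and a product
operator acts by conjugation on each tensor factor separately (`LocIn.conj_piTensor`). The same
notion is used for sites and, after grouping the sites in pairs, for gates (`locIn_pairSub_iff`).
-/

set_option linter.unusedSectionVars false

namespace BernoulliCircuit

/-! ### Operators on a lattice of sites, one site at a time -/

section LocalOperators

variable {ι κ : Type*} [Fintype ι] [DecidableEq ι] [Fintype κ] [DecidableEq κ]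

/-- The tensor product `⨂ z, A z` of one-site operators, in the product basis. -/
def piTensor (A : ι → Matrix κ κ ℂ) : Matrix (ι → κ) (ι → κ) ℂ :=
  of fun σ τ => ∏ z, A z (σ z) (τ z)

theorem piTensor_mul (A B : ι → Matrix κ κ ℂ) :
    piTensor A * piTensor B = piTensor fun z => A z * B z := by
  ext σ τ
  simp only [piTensor, mul_apply, of_apply, ← Finset.prod_mul_distrib]
  rw [Finset.prod_univ_sum, Fintype.piFinset_univ]

theorem piTensor_one : piTensor (fun _ : ι => (1 : Matrix κ κ ℂ)) = 1 := by
  ext σ τ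
  simp only [piTensor, of_apply, one_apply, Finset.prod_ite_zero, Finset.prod_const_one,
    Finset.mem_univ, true_imp_iff, funext_iff]

theorem piTensor_conjTranspose (A : ι → Matrix κ κ ℂ) :
    (piTensor A)ᴴ = piTensor fun z => (A z)ᴴ := by
  ext σ τ
  simp [piTensor, conjTranspose_apply]

/-- The block of `X` on the site `s`: the one-site operator obtained by fixing the configurations
`σ` and `τ` at all the other sites. -/
def slice (s : ι) (X : Matrix (ι → κ) (ι → κ) ℂ) (σ τ : ι → κ) : Matrix κ κ ℂ :=
  X.submatrix (Function.update σ s) (Function.update τ s)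

/-- `X` lies in `W ⊗ (operators on the other sites)`, the factor `W` being located at the site `s`;
in coordinates, all blocks of `X` on `s` are in `W`. -/
def LocIn (W : Submodule ℂ (Matrix κ κ ℂ)) (s : ι) (X : Matrix (ι → κ) (ι → κ) ℂ) : Prop :=
  ∀ σ τ, slice s X σ τ ∈ W

/-- The traceless one-site operators. -/
def traceless (κ : Type*) [Fintype κ] : Submodule ℂ (Matrix κ κ ℂ) :=
  LinearMap.ker (traceLinearMap κ ℂ ℂ)

/-- The multiples of the identity. -/
def scalars (κ : Type*) [DecidableEq κ] : Submodule ℂ (Matrix κ κ ℂ) :=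
  Submodule.span ℂ {1}

theorem mem_traceless {x : Matrix κ κ ℂ} : x ∈ traceless κ ↔ x.trace = 0 := by
  simp [traceless]

theorem mem_scalars {x : Matrix κ κ ℂ} : x ∈ scalars κ ↔ ∃ c : ℂ, c • 1 = x :=
  Submodule.mem_span_singleton

theorem LocIn.sub {W : Submodule ℂ (Matrix κ κ ℂ)} {s : ι} {X Y : Matrix (ι → κ) (ι → κ) ℂ}
    (hX : LocIn W s X) (hY : LocIn W s Y) : LocIn W s (X - Y) :=
  fun σ τ => W.sub_mem (hX σ τ) (hY σ τ)

/-- Relabelling the configurations so that the site `s` goes to the site `s'`. -/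
theorem LocIn.submatrix {W : Submodule ℂ (Matrix κ κ ℂ)} {s s' : ι}
    {X : Matrix (ι → κ) (ι → κ) ℂ} (hX : LocIn W s' X) (f : (ι → κ) → ι → κ)
    (hf : ∀ σ i, f (Function.update σ s i) = Function.update (f σ) s' i) :
    LocIn W s (X.submatrix f f) := by
  intro σ τ
  convert hX (f σ) (f τ) using 1
  ext i k
  simp [slice, hf]

theorem slice_piTensor (A : ι → Matrix κ κ ℂ) (s : ι) (σ τ : ι → κ) :
    slice s (piTensor A) σ τ = (∏ z ∈ Finset.univ.erase s, A z (σ z) (τ z)) • A s := by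
  ext i k
  simp only [slice, piTensor, submatrix_apply, of_apply, Matrix.smul_apply, smul_eq_mul]
  rw [← Finset.prod_erase_mul _ _ (Finset.mem_univ s)]
  simp only [Function.update_self]
  congr 1
  refine Finset.prod_congr rfl fun z hz => ?_
  rw [Function.update_of_ne (Finset.ne_of_mem_erase hz),
    Function.update_of_ne (Finset.ne_of_mem_erase hz)]

theorem LocIn.piTensor {W : Submodule ℂ (Matrix κ κ ℂ)} {A : ι → Matrix κ κ ℂ} {s : ι}
    (h : A s ∈ W) : LocIn W s (piTensor A) := fun σ τ => by
  rw [slice_piTensor]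
  exact W.smul_mem _ h

/-- Summation over the value at one site first: each configuration is then counted `card κ`
times. -/
theorem card_mul_sum_config (s : ι) (f : (ι → κ) → ℂ) :
    (Fintype.card κ : ℂ) * ∑ μ, f μ = ∑ μ, ∑ x, f (Function.update μ s x) := by
  -- Exchanging the value at `s` with the extra variable is an involution.
  have hinv : Function.Involutive fun p : (ι → κ) × κ => (Function.update p.1 s p.2, p.1 s) := by
    rintro ⟨μ, x⟩
    simp
  rw [← Fintype.sum_prod_type' (f := fun μ x => f (Function.update μ s x)),
    Fintype.sum_equiv hinv.toPerm
      (fun p : (ι → κ) × κ => f (Function.update p.1 s p.2)) (fun p : (ι → κ) × κ => f p.1)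
      (fun _ => rfl),
    Fintype.sum_prod_type' (f := fun μ _ => f μ)]
  simp [Finset.mul_sum]

theorem sum_config [Nonempty κ] (s : ι) (f : (ι → κ) → ℂ) :
    ∑ μ, f μ = (Fintype.card κ : ℂ)⁻¹ * ∑ μ, ∑ x, f (Function.update μ s x) := by
  rw [← card_mul_sum_config, inv_mul_cancel_left₀ (by simp)]

theorem trace_eq_zero_of_locIn [Nonempty κ] {s : ι} {X : Matrix (ι → κ) (ι → κ) ℂ}
    (hX : LocIn (traceless κ) s X) : X.trace = 0 := by
  rw [trace, sum_config s]
  have h : ∀ μ : ι → κ, ∑ x, X.diag (Function.update μ s x) = 0 := fun μ =>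
    mem_traceless.1 (hX μ μ)
  rw [Finset.sum_eq_zero fun μ _ => h μ, mul_zero]

theorem LocIn.piTensor_mul [Nonempty κ] {W W' : Submodule ℂ (Matrix κ κ ℂ)}
    {A : ι → Matrix κ κ ℂ} {s : ι} {X : Matrix (ι → κ) (ι → κ) ℂ} (hX : LocIn W s X)
    (h : ∀ x ∈ W, A s * x ∈ W') : LocIn W' s (BernoulliCircuit.piTensor A * X) := by
  intro σ τ
  have key : slice s (BernoulliCircuit.piTensor A * X) σ τ = (Fintype.card κ : ℂ)⁻¹ •
      ∑ μ, (∏ z ∈ Finset.univ.erase s, A z (σ z) (μ z)) • (A s * slice s X μ τ) := by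
    ext i k
    simp only [slice, submatrix_apply, mul_apply, Matrix.smul_apply, Matrix.sum_apply, smul_eq_mul]
    rw [sum_config s]
    congr 1
    refine Finset.sum_congr rfl fun μ _ => ?_
    rw [Finset.mul_sum]
    refine Finset.sum_congr rfl fun x _ => ?_
    have := congr_fun₂ (slice_piTensor A s σ μ) i x
    simp only [slice, submatrix_apply, Matrix.smul_apply, smul_eq_mul] at this
    rw [this, mul_assoc]
  rw [key]
  exact W'.smul_mem _ (W'.sum_mem fun μ _ => W'.smul_mem _ (h _ (hX μ τ)))

theorem LocIn.mul_piTensor [Nonempty κ] {W W' : Submodule ℂ (Matrix κ κ ℂ)}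
    {A : ι → Matrix κ κ ℂ} {s : ι} {X : Matrix (ι → κ) (ι → κ) ℂ} (hX : LocIn W s X)
    (h : ∀ x ∈ W, x * A s ∈ W') : LocIn W' s (X * BernoulliCircuit.piTensor A) := by
  intro σ τ
  have key : slice s (X * BernoulliCircuit.piTensor A) σ τ = (Fintype.card κ : ℂ)⁻¹ •
      ∑ μ, (∏ z ∈ Finset.univ.erase s, A z (μ z) (τ z)) • (slice s X σ μ * A s) := by
    ext i k
    simp only [slice, submatrix_apply, mul_apply, Matrix.smul_apply, Matrix.sum_apply, smul_eq_mul]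
    rw [sum_config s]
    congr 1
    refine Finset.sum_congr rfl fun μ _ => ?_
    rw [Finset.mul_sum]
    refine Finset.sum_congr rfl fun x _ => ?_
    have := congr_fun₂ (slice_piTensor A s μ τ) x k
    simp only [slice, submatrix_apply, Matrix.smul_apply, smul_eq_mul] at this
    rw [this, mul_left_comm]
  rw [key]
  exact W'.smul_mem _ (W'.sum_mem fun μ _ => W'.smul_mem _ (h _ (hX σ μ)))

/-- Conjugation by a product operator acts on each tensor factor separately. -/
theorem LocIn.conj_piTensor [Nonempty κ] {W W' : Submodule ℂ (Matrix κ κ ℂ)}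
    {A B : ι → Matrix κ κ ℂ} {s : ι} {X : Matrix (ι → κ) (ι → κ) ℂ} (hX : LocIn W s X)
    (h : ∀ x ∈ W, A s * x * B s ∈ W') :
    LocIn W' s (BernoulliCircuit.piTensor A * X * BernoulliCircuit.piTensor B) := by
  refine (hX.piTensor_mul (W' := W.map (LinearMap.mulLeft ℂ (A s)))
    fun x hx => ⟨x, hx, rfl⟩).mul_piTensor ?_
  rintro _ ⟨x, hx, rfl⟩
  exact h x hx

/-- A product operator has no overlap with an operator that is traceless at a site where the
product operator is the identity. -/
theorem trace_piTensor_mul_eq_zero [Nonempty κ] {A : ι → Matrix κ κ ℂ} {s : ι}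
    {X : Matrix (ι → κ) (ι → κ) ℂ} (hA : A s = 1) (hX : LocIn (traceless κ) s X) :
    (piTensor A * X).trace = 0 :=
  trace_eq_zero_of_locIn (hX.piTensor_mul fun x hx => by rwa [hA, one_mul])

/-- The normalised partial trace over the site `s`, followed by tensoring with the identity
at `s`: the projection of `X` onto the operators that are trivial at `s`. -/
noncomputable def siteAverage (s : ι) (X : Matrix (ι → κ) (ι → κ) ℂ) : Matrix (ι → κ) (ι → κ) ℂ :=
  of fun σ τ => if σ s = τ s then (Fintype.card κ : ℂ)⁻¹ * (slice s X σ τ).trace else 0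

theorem slice_siteAverage_self (s : ι) (X : Matrix (ι → κ) (ι → κ) ℂ) (σ τ : ι → κ) :
    slice s (siteAverage s X) σ τ =
      ((Fintype.card κ : ℂ)⁻¹ * (slice s X σ τ).trace) • (1 : Matrix κ κ ℂ) := by
  ext i k
  have h : ∀ i k, slice s X (Function.update σ s i) (Function.update τ s k) = slice s X σ τ := by
    intro i k
    ext
    simp [slice]
  rw [slice, submatrix_apply, siteAverage, of_apply, h]
  simp [one_apply]

theorem locIn_scalars_siteAverage (s : ι) (X : Matrix (ι → κ) (ι → κ) ℂ) :
    LocIn (scalars κ) s (siteAverage s X) := fun σ τ =>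
  mem_scalars.2 ⟨_, (slice_siteAverage_self s X σ τ).symm⟩

theorem locIn_traceless_sub_siteAverage [Nonempty κ] (s : ι) (X : Matrix (ι → κ) (ι → κ) ℂ) :
    LocIn (traceless κ) s (X - siteAverage s X) := fun σ τ => by
  have h : slice s (X - siteAverage s X) σ τ =
      slice s X σ τ - slice s (siteAverage s X) σ τ := rfl
  rw [mem_traceless, h, trace_sub, slice_siteAverage_self, trace_smul, trace_one, smul_eq_mul,
    mul_right_comm, inv_mul_cancel₀ (by simp), one_mul, sub_self]

theorem LocIn.siteAverage {W : Submodule ℂ (Matrix κ κ ℂ)} {s s' : ι} (hs : s' ≠ s)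
    {X : Matrix (ι → κ) (ι → κ) ℂ} (hX : LocIn W s' X) :
    LocIn W s' (BernoulliCircuit.siteAverage s X) := fun σ τ => by
  have key : slice s' (BernoulliCircuit.siteAverage s X) σ τ =
      (if σ s = τ s then (Fintype.card κ : ℂ)⁻¹ else 0) •
        ∑ j, slice s' X (Function.update σ s j) (Function.update τ s j) := by
    ext i k
    simp only [slice, BernoulliCircuit.siteAverage, submatrix_apply, of_apply, Matrix.smul_apply,
      Matrix.sum_apply, smul_eq_mul, Function.update_of_ne hs.symm, trace, diag_apply, ite_mul,
      zero_mul]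
    simp only [Function.update_comm hs]
  rw [key]
  exact W.smul_mem _ (W.sum_mem fun j _ => hX _ _)

/-- The partial trace of `X` over the two sites `s` and `s'` vanishes. -/
def JointlyTraceless (s s' : ι) (X : Matrix (ι → κ) (ι → κ) ℂ) : Prop :=
  ∀ σ τ : ι → κ, ∑ i, ∑ j, X (Function.update (Function.update σ s i) s' j)
    (Function.update (Function.update τ s i) s' j) = 0

theorem JointlyTraceless.of_left {s s' : ι} (hs : s ≠ s') {X : Matrix (ι → κ) (ι → κ) ℂ}
    (hX : LocIn (traceless κ) s X) : JointlyTraceless s s' X := fun σ τ => by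
  rw [Finset.sum_comm]
  refine Finset.sum_eq_zero fun j _ => ?_
  simp only [Function.update_comm hs]
  exact mem_traceless.1 (hX _ _)

theorem JointlyTraceless.of_right {s s' : ι} {X : Matrix (ι → κ) (ι → κ) ℂ}
    (hX : LocIn (traceless κ) s' X) : JointlyTraceless s s' X := fun _ _ =>
  Finset.sum_eq_zero fun _ _ => mem_traceless.1 (hX _ _)

theorem JointlyTraceless.siteAverage_eq_zero {s s' : ι} (hs : s' ≠ s)
    {X : Matrix (ι → κ) (ι → κ) ℂ} (hX : JointlyTraceless s s' X) :
    siteAverage s (siteAverage s' X) = 0 := by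
  ext σ τ
  simp only [siteAverage, slice, trace, diag_apply, submatrix_apply, of_apply,
    Function.update_of_ne hs]
  split_ifs
  · rw [← Finset.mul_sum, hX σ τ]
    simp
  · simp
  · rfl

/-- The expansion of an operator with vanishing partial trace over two sites into a part that is
traceless at both sites and two parts that are traceless at one site and trivial at the other. -/
theorem JointlyTraceless.exists_decomposition [Nonempty κ] {s s' : ι} (hs : s' ≠ s)
    {X : Matrix (ι → κ) (ι → κ) ℂ} (hX : JointlyTraceless s s' X) :
    ∃ Y Yl Yr : Matrix (ι → κ) (ι → κ) ℂ, X = Y + Yl + Yr ∧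
      (LocIn (traceless κ) s Y ∧ LocIn (traceless κ) s' Y) ∧
      (LocIn (traceless κ) s Yl ∧ LocIn (scalars κ) s' Yl) ∧
      (LocIn (scalars κ) s Yr ∧ LocIn (traceless κ) s' Yr) ∧
      ∀ y, y ≠ s → y ≠ s' → LocIn (scalars κ) y X →
        LocIn (scalars κ) y Y ∧ LocIn (scalars κ) y Yl ∧ LocIn (scalars κ) y Yr := by
  have h' := locIn_traceless_sub_siteAverage s' X
  refine ⟨X - siteAverage s' X - siteAverage s (X - siteAverage s' X), siteAverage s' X,
    siteAverage s (X - siteAverage s' X), by abel,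
    ⟨locIn_traceless_sub_siteAverage _ _, h'.sub (h'.siteAverage hs)⟩,
    ⟨?_, locIn_scalars_siteAverage _ _⟩, ⟨locIn_scalars_siteAverage _ _, h'.siteAverage hs⟩, ?_⟩
  · have := locIn_traceless_sub_siteAverage s (siteAverage s' X)
    rwa [hX.siteAverage_eq_zero hs, sub_zero] at this
  · intro y hy hy' hXy
    have h1 := hXy.siteAverage hy'
    have h2 := (hXy.sub h1).siteAverage hy
    exact ⟨(hXy.sub h1).sub h2, h1, h2⟩

end LocalOperators

/-! ### Conjugation by a 2-unitary gate -/

section TwoBodyOperators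

variable {q : ℕ}

/-- The two-particle operators in `Wl ⊗ Wr`: all their blocks on the left particle are in `Wl`,
and all their blocks on the right particle are in `Wr`. -/
def pairSub (Wl Wr : Submodule ℂ (Matrix (Fin q) (Fin q) ℂ)) : Submodule ℂ (TwoBody q) where
  carrier := {x | (∀ j l, (of fun i k => x (i, j) (k, l)) ∈ Wl) ∧
    ∀ i k, (of fun j l => x (i, j) (k, l)) ∈ Wr}
  zero_mem' := ⟨fun _ _ => Wl.zero_mem, fun _ _ => Wr.zero_mem⟩
  add_mem' hx hy := ⟨fun j l => Wl.add_mem (hx.1 j l) (hy.1 j l),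
    fun i k => Wr.add_mem (hx.2 i k) (hy.2 i k)⟩
  smul_mem' c _ hx := ⟨fun j l => Wl.smul_mem c (hx.1 j l), fun i k => Wr.smul_mem c (hx.2 i k)⟩

theorem conj_apply (U x : TwoBody q) (i j k l : Fin q) :
    (Uᴴ * x * U) (i, j) (k, l) = ∑ k', ∑ l', ∑ i', ∑ j',
      star (U (i', j') (i, j)) * x (i', j') (k', l') * U (k', l') (k, l) := by
  simp only [mul_apply, conjTranspose_apply, Fintype.sum_prod_type, Finset.sum_mul]

theorem eq_scalar_of_mem_pairSub [NeZero q] {x : TwoBody q}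
    (hx : x ∈ pairSub (scalars (Fin q)) (scalars (Fin q))) : ∃ c : ℂ, x = c • 1 := by
  obtain ⟨hl, hr⟩ := hx
  simp only [mem_scalars] at hl hr
  choose f hf using hl
  choose g hg using hr
  have hf' : ∀ i j k l, x (i, j) (k, l) = if i = k then f j l else 0 := fun i j k l => by
    simpa [one_apply] using (congr_fun₂ (hf j l) i k).symm
  have hg' : ∀ i j k l, x (i, j) (k, l) = if j = l then g i k else 0 := fun i j k l => by
    simpa [one_apply] using (congr_fun₂ (hg i k) j l).symm
  refine ⟨g 0 0, ?_⟩
  ext ⟨i, j⟩ ⟨k, l⟩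
  have h1 := hg' 0 j 0 l
  rw [hf' 0 j 0 l] at h1
  rw [hf' i j k l]
  simp only [if_true] at h1
  rw [h1]
  by_cases hik : i = k <;> by_cases hjl : j = l <;> simp [one_apply, hik, hjl]

theorem conj_mem_scalars [NeZero q] {U : TwoBody q} (hU : U ∈ unitaryGroup (Fin q × Fin q) ℂ)
    {x : TwoBody q} (hx : x ∈ pairSub (scalars (Fin q)) (scalars (Fin q))) :
    Uᴴ * x * U ∈ pairSub (scalars (Fin q)) (scalars (Fin q)) := by
  obtain ⟨c, rfl⟩ := eq_scalar_of_mem_pairSub hx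
  have h : Uᴴ * U = 1 := mem_unitaryGroup_iff'.1 hU
  rw [Matrix.mul_smul, mul_one, Matrix.smul_mul, h]
  refine (pairSub _ _).smul_mem c ⟨fun j l => mem_scalars.2 ⟨if j = l then 1 else 0, ?_⟩,
    fun i k => mem_scalars.2 ⟨if i = k then 1 else 0, ?_⟩⟩
  · ext i k
    by_cases h : i = k <;> simp [one_apply, h]
  · ext j l
    by_cases h : j = l <;> simp [one_apply, h]

theorem conj_trace_eq_zero {U : TwoBody q} (hU : U ∈ unitaryGroup (Fin q × Fin q) ℂ)
    {x : TwoBody q} (hx : x ∈ traceless (Fin q × Fin q)) :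
    Uᴴ * x * U ∈ traceless (Fin q × Fin q) := by
  have h : U * Uᴴ = 1 := mem_unitaryGroup_iff.1 hU
  rw [mem_traceless] at hx ⊢
  rw [trace_mul_comm, ← mul_assoc, h, one_mul, hx]

/-- Unitarity of the realignment, read as the contraction of two copies of the gate along both
their right legs. The three lemmas below are the other contractions along one incoming and one
outgoing leg: legs on the same side use the realignment, legs on opposite sides the partial
transpose. -/
theorem sum_realign_left {U : TwoBody q} (h : realign U ∈ unitaryGroup (Fin q × Fin q) ℂ)
    (i i' k k' : Fin q) :
    ∑ j, ∑ j', star (U (i', j') (i, j)) * U (k', j') (k, j) = if i = k ∧ i' = k' then 1 else 0 := by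
  have := congr_fun₂ (mem_unitaryGroup_iff'.1 h) (i, i') (k, k')
  simpa [mul_apply, star_eq_conjTranspose, realign, Fintype.sum_prod_type, one_apply] using this

theorem sum_realign_right {U : TwoBody q} (h : realign U ∈ unitaryGroup (Fin q × Fin q) ℂ)
    (j j' l l' : Fin q) :
    ∑ i, ∑ i', star (U (i', j') (i, j)) * U (i', l') (i, l) = if j = l ∧ j' = l' then 1 else 0 := by
  have := congr_fun₂ (mem_unitaryGroup_iff.1 h) (l, l') (j, j')
  simpa [mul_apply, star_eq_conjTranspose, realign, Fintype.sum_prod_type, one_apply, mul_comm,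
    eq_comm] using this

theorem sum_partialTranspose_left {U : TwoBody q}
    (h : partialTranspose U ∈ unitaryGroup (Fin q × Fin q) ℂ) (i' j k' l : Fin q) :
    ∑ i, ∑ j', star (U (i', j') (i, j)) * U (k', j') (i, l) = if i' = k' ∧ j = l then 1 else 0 := by
  have := congr_fun₂ (mem_unitaryGroup_iff.1 h) (k', l) (i', j)
  simpa [mul_apply, star_eq_conjTranspose, partialTranspose, Fintype.sum_prod_type, one_apply,
    mul_comm, eq_comm] using this

theorem sum_partialTranspose_right {U : TwoBody q}
    (h : partialTranspose U ∈ unitaryGroup (Fin q × Fin q) ℂ) (i j' k l' : Fin q) :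
    ∑ j, ∑ i', star (U (i', j') (i, j)) * U (i', l') (k, j) = if i = k ∧ j' = l' then 1 else 0 := by
  have := congr_fun₂ (mem_unitaryGroup_iff'.1 h) (i, j') (k, l')
  rw [Finset.sum_comm]
  simpa [mul_apply, star_eq_conjTranspose, partialTranspose, Fintype.sum_prod_type, one_apply]
    using this

/-- A traceless operator on the left leg of a gate becomes traceless on both legs. -/
theorem conj_mem_of_left {U : TwoBody q} (hU : IsTwoUnitary U) {x : TwoBody q}
    (hx : x ∈ pairSub (traceless (Fin q)) (scalars (Fin q))) :
    Uᴴ * x * U ∈ pairSub (traceless (Fin q)) (traceless (Fin q)) := by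
  obtain ⟨hl, hr⟩ := hx
  simp only [mem_scalars] at hr
  choose y hy using hr
  have hy' : ∀ i j k l, x (i, j) (k, l) = if j = l then y i k else 0 := fun i j k l => by
    simpa [one_apply] using (congr_fun₂ (hy i k) j l).symm
  have hc : ∀ i j k l, (Uᴴ * x * U) (i, j) (k, l) =
      ∑ k', ∑ i', y i' k' * ∑ j', star (U (i', j') (i, j)) * U (k', j') (k, l) := by
    intro i j k l
    rw [conj_apply]
    refine Finset.sum_congr rfl fun k' _ => ?_
    rw [Finset.sum_comm]
    refine Finset.sum_congr rfl fun i' _ => ?_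
    simp only [hy', mul_ite, ite_mul, mul_zero, zero_mul]
    rw [Finset.sum_comm, Finset.mul_sum]
    refine Finset.sum_congr rfl fun j' _ => ?_
    simp only [Finset.sum_ite_eq, Finset.mem_univ, if_true]
    ring
  have hzero : ∀ j : Fin q, ∑ k', y k' k' = 0 := fun j => by
    simpa [trace, hy'] using mem_traceless.1 (hl j j)
  refine ⟨fun j l => mem_traceless.2 ?_, fun i k => mem_traceless.2 ?_⟩
  · simp only [trace, diag_apply, of_apply, hc]
    rw [Finset.sum_comm]
    have : ∀ k', ∑ i, ∑ i', y i' k' * ∑ j', star (U (i', j') (i, j)) * U (k', j') (i, l) =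
        if j = l then y k' k' else 0 := by
      intro k'
      rw [Finset.sum_comm]
      simp_rw [← Finset.mul_sum, sum_partialTranspose_left hU.2.2]
      by_cases h : j = l <;> simp [h]
    simp only [this]
    split_ifs
    · exact hzero j
    · simp
  · simp only [trace, diag_apply, of_apply, hc]
    rw [Finset.sum_comm]
    have : ∀ k', ∑ j, ∑ i', y i' k' * ∑ j', star (U (i', j') (i, j)) * U (k', j') (k, j) =
        if i = k then y k' k' else 0 := by
      intro k'
      rw [Finset.sum_comm]
      simp_rw [← Finset.mul_sum, sum_realign_left hU.1.2]
      by_cases h : i = k <;> simp [h]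
    simp only [this]
    split_ifs
    · exact hzero i
    · simp

/-- A traceless operator on the right leg of a gate becomes traceless on both legs. -/
theorem conj_mem_of_right {U : TwoBody q} (hU : IsTwoUnitary U) {x : TwoBody q}
    (hx : x ∈ pairSub (scalars (Fin q)) (traceless (Fin q))) :
    Uᴴ * x * U ∈ pairSub (traceless (Fin q)) (traceless (Fin q)) := by
  obtain ⟨hl, hr⟩ := hx
  simp only [mem_scalars] at hl
  choose y hy using hl
  have hy' : ∀ i j k l, x (i, j) (k, l) = if i = k then y j l else 0 := fun i j k l => by
    simpa [one_apply] using (congr_fun₂ (hy j l) i k).symm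
  have hc : ∀ i j k l, (Uᴴ * x * U) (i, j) (k, l) =
      ∑ l', ∑ j', y j' l' * ∑ i', star (U (i', j') (i, j)) * U (i', l') (k, l) := by
    intro i j k l
    rw [conj_apply, Finset.sum_comm]
    refine Finset.sum_congr rfl fun l' _ => ?_
    simp only [hy', mul_ite, ite_mul, mul_zero, zero_mul]
    rw [Finset.sum_comm]
    simp only [Finset.mul_sum]
    rw [Finset.sum_comm (γ := Fin q) (α := Fin q) (s := Finset.univ) (t := Finset.univ)
      (f := fun j' i' => y j' l' * (star (U (i', j') (i, j)) * U (i', l') (k, l)))]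
    refine Finset.sum_congr rfl fun i' _ => ?_
    rw [Finset.sum_comm]
    refine Finset.sum_congr rfl fun j' _ => ?_
    simp only [Finset.sum_ite_eq, Finset.mem_univ, if_true]
    ring
  have hzero : ∀ j : Fin q, ∑ k', y k' k' = 0 := fun j => by
    simpa [trace, hy'] using mem_traceless.1 (hr j j)
  refine ⟨fun j l => mem_traceless.2 ?_, fun i k => mem_traceless.2 ?_⟩
  · simp only [trace, diag_apply, of_apply, hc]
    rw [Finset.sum_comm]
    have : ∀ l', ∑ i, ∑ j', y j' l' * ∑ i', star (U (i', j') (i, j)) * U (i', l') (i, l) =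
        if j = l then y l' l' else 0 := by
      intro l'
      rw [Finset.sum_comm]
      simp_rw [← Finset.mul_sum, sum_realign_right hU.1.2]
      by_cases h : j = l <;> simp [h]
    simp only [this]
    split_ifs
    · exact hzero j
    · simp
  · simp only [trace, diag_apply, of_apply, hc]
    rw [Finset.sum_comm]
    have : ∀ l', ∑ j, ∑ j', y j' l' * ∑ i', star (U (i', j') (i, j)) * U (i', l') (k, j) =
        if i = k then y l' l' else 0 := by
      intro l'
      rw [Finset.sum_comm]
      simp_rw [← Finset.mul_sum, sum_partialTranspose_right hU.2.2]
      by_cases h : i = k <;> simp [h]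
    simp only [this]
    split_ifs
    · exact hzero i
    · simp

end TwoBodyOperators

/-! ### Layers of gates -/

section Layers

variable {q L : ℕ} [NeZero L]

theorem site_ne {m n : ℤ} (h : m < n) (h' : n < m + 2 * L) : (m : ZMod (2 * L)) ≠ n := by
  rw [Ne, ZMod.intCast_eq_intCast_iff_dvd_sub]
  intro hd
  have := Int.le_of_dvd (by omega) hd
  push_cast at this
  omega

/-- Every even integer names the left leg of a gate of the even layer. -/
theorem exists_gate (m : ℤ) :
    ∃ z : Fin L, ((2 * m : ℤ) : ZMod (2 * L)) = 2 * ((z : ℕ) : ZMod (2 * L)) := by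
  have hL : (0 : ℤ) < L := by exact_mod_cast Nat.pos_of_ne_zero (NeZero.ne L)
  have h0 := Int.emod_nonneg m hL.ne'
  have h1 := Int.emod_lt_of_pos m hL
  refine ⟨⟨(m % L).toNat, by omega⟩, ?_⟩
  have h2 : ((2 * (m % L).toNat : ℕ) : ZMod (2 * L)) = ((2 * (m % L) : ℤ) : ZMod (2 * L)) := by
    conv_rhs => rw [← Int.toNat_of_nonneg h0]
    push_cast
    rfl
  push_cast at h2 ⊢
  rw [h2, ← Int.cast_ofNat, ← Int.cast_mul, ← Int.cast_mul, ZMod.intCast_eq_intCast_iff_dvd_sub]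
  refine ⟨-(m / L), ?_⟩
  have := Int.mul_ediv_add_emod m L
  push_cast
  linear_combination 2 * this

theorem exists_gate_site (s : ZMod (2 * L)) :
    ∃ z : Fin L, s = 2 * ((z : ℕ) : ZMod (2 * L)) ∨ s = 2 * ((z : ℕ) : ZMod (2 * L)) + 1 := by
  obtain ⟨n, rfl⟩ := ZMod.intCast_surjective s
  obtain ⟨m, hm | hm⟩ := Int.even_or_odd' n
  · obtain ⟨z, hz⟩ := exists_gate (L := L) m
    exact ⟨z, Or.inl (by rw [hm, hz])⟩
  · obtain ⟨z, hz⟩ := exists_gate (L := L) m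
    exact ⟨z, Or.inr (by rw [hm, Int.cast_add, hz, Int.cast_one])⟩

theorem gate_left_ne_left {z z' : Fin L} (h : z' ≠ z) :
    (2 * ((z' : ℕ) : ZMod (2 * L))) ≠ 2 * ((z : ℕ) : ZMod (2 * L)) := by
  have hz := z.2
  have hz' := z'.2
  have hne : (z' : ℕ) ≠ z := fun h' => h (Fin.ext h')
  rcases lt_or_gt_of_ne hne with h | h
  · have := site_ne (L := L) (m := 2 * (z' : ℕ)) (n := 2 * (z : ℕ)) (by omega) (by omega)
    push_cast at this
    exact this
  · have := site_ne (L := L) (m := 2 * (z : ℕ)) (n := 2 * (z' : ℕ)) (by omega) (by omega)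
    push_cast at this
    exact this.symm

theorem gate_right_ne_left (z z' : Fin L) :
    (2 * ((z' : ℕ) : ZMod (2 * L))) + 1 ≠ 2 * ((z : ℕ) : ZMod (2 * L)) := by
  have hz := z.2
  have hz' := z'.2
  rcases lt_or_ge (z' : ℕ) z with h | h
  · have := site_ne (L := L) (m := 2 * (z' : ℕ) + 1) (n := 2 * (z : ℕ)) (by omega) (by omega)
    push_cast at this
    exact this
  · have := site_ne (L := L) (m := 2 * (z : ℕ)) (n := 2 * (z' : ℕ) + 1) (by omega) (by omega)
    push_cast at this
    exact this.symm

/-- The configurations of the chain, read off gate by gate for the even layer. -/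
noncomputable def gateEquiv (q L : ℕ) [NeZero L] : Config q L ≃ (Fin L → Fin q × Fin q) :=
  Equiv.ofBijective
    (fun σ z => (σ (2 * ((z : ℕ) : ZMod (2 * L))), σ (2 * ((z : ℕ) : ZMod (2 * L)) + 1))) <| by
    rw [Fintype.bijective_iff_injective_and_card]
    refine ⟨fun σ τ h => ?_, ?_⟩
    · funext s
      obtain ⟨z, rfl | rfl⟩ := exists_gate_site s
      · exact congr_arg Prod.fst (congr_fun h z)
      · exact congr_arg Prod.snd (congr_fun h z)
    · simp [ZMod.card, pow_mul, sq]

theorem gateEquiv_update (z : Fin L) (σ : Config q L) (i j : Fin q) :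
    gateEquiv q L (Function.update (Function.update σ (2 * ((z : ℕ) : ZMod (2 * L))) i)
      (2 * ((z : ℕ) : ZMod (2 * L)) + 1) j) = Function.update (gateEquiv q L σ) z (i, j) := by
  funext z'
  simp only [gateEquiv, Equiv.ofBijective_apply]
  rw [Function.update_of_ne (gate_right_ne_left z' z).symm]
  by_cases h : z' = z
  · subst h
    simp
  · rw [Function.update_of_ne (gate_left_ne_left h), Function.update_of_ne (a := 2 * _ + 1),
      Function.update_of_ne (gate_right_ne_left z z'), Function.update_of_ne h]
    exact fun h' => gate_left_ne_left h (add_right_cancel h')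

theorem gateEquiv_symm_update (z : Fin L) (ρ : Fin L → Fin q × Fin q) (i j : Fin q) :
    (gateEquiv q L).symm (Function.update ρ z (i, j)) =
      Function.update (Function.update ((gateEquiv q L).symm ρ) (2 * ((z : ℕ) : ZMod (2 * L))) i)
        (2 * ((z : ℕ) : ZMod (2 * L)) + 1) j := by
  rw [Equiv.symm_apply_eq, gateEquiv_update, Equiv.apply_symm_apply]

/-- The operator `X` in the basis of the gates of the even layer. -/
noncomputable def gateBasis (X : ChainOp q L) :
    Matrix (Fin L → Fin q × Fin q) (Fin L → Fin q × Fin q) ℂ :=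
  X.submatrix (gateEquiv q L).symm (gateEquiv q L).symm

theorem slice_gateBasis (X : ChainOp q L) (z : Fin L) (ρ ρ' : Fin L → Fin q × Fin q)
    (i j k l : Fin q) : slice z (gateBasis X) ρ ρ' (i, j) (k, l) =
      X (Function.update (Function.update ((gateEquiv q L).symm ρ) (2 * ((z : ℕ) : ZMod (2 * L))) i)
        (2 * ((z : ℕ) : ZMod (2 * L)) + 1) j)
      (Function.update (Function.update ((gateEquiv q L).symm ρ') (2 * ((z : ℕ) : ZMod (2 * L))) k)
        (2 * ((z : ℕ) : ZMod (2 * L)) + 1) l) := by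
  simp only [slice, gateBasis, submatrix_apply, gateEquiv_symm_update]

/-- The two legs of a gate can be examined separately. -/
theorem locIn_pairSub_iff {Wl Wr : Submodule ℂ (Matrix (Fin q) (Fin q) ℂ)} (X : ChainOp q L)
    (z : Fin L) : LocIn (pairSub Wl Wr) z (gateBasis X) ↔
      LocIn Wl (2 * ((z : ℕ) : ZMod (2 * L))) X ∧
        LocIn Wr (2 * ((z : ℕ) : ZMod (2 * L)) + 1) X := by
  have hne := gate_right_ne_left (L := L) z z
  constructor
  · refine fun h => ⟨fun σ τ => ?_, fun σ τ => ?_⟩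
    · convert (h (gateEquiv q L σ) (gateEquiv q L τ)).1
        (σ (2 * ((z : ℕ) : ZMod (2 * L)) + 1)) (τ (2 * ((z : ℕ) : ZMod (2 * L)) + 1)) using 1
      ext i k
      simp only [of_apply, slice_gateBasis, Equiv.symm_apply_apply, Function.update_comm hne.symm,
        Function.update_eq_self]
      rfl
    · convert (h (gateEquiv q L σ) (gateEquiv q L τ)).2
        (σ (2 * ((z : ℕ) : ZMod (2 * L)))) (τ (2 * ((z : ℕ) : ZMod (2 * L)))) using 1
      ext j l
      simp only [of_apply, slice_gateBasis, Equiv.symm_apply_apply, Function.update_eq_self]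
      rfl
  · rintro ⟨hl, hr⟩ ρ ρ'
    refine ⟨fun j l => ?_, fun i k => ?_⟩
    · simp only [slice_gateBasis, Function.update_comm hne.symm]
      exact hl _ _
    · simp only [slice_gateBasis]
      exact hr _ _

theorem evenLayer_eq (U : TwoBody q) (L : ℕ) [NeZero L] :
    evenLayer U L =
      (piTensor fun _ : Fin L => U).submatrix (gateEquiv q L) (gateEquiv q L) := rfl

theorem gateBasis_conj (U : TwoBody q) (X : ChainOp q L) :
    gateBasis ((evenLayer U L)ᴴ * X * evenLayer U L) =
      (piTensor fun _ : Fin L => Uᴴ) * gateBasis X * piTensor fun _ : Fin L => U := by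
  rw [gateBasis, evenLayer_eq, conjTranspose_submatrix, piTensor_conjTranspose,
    ← submatrix_mul_equiv _ _ _ (gateEquiv q L).symm,
    ← submatrix_mul_equiv _ _ _ (gateEquiv q L).symm]
  simp [gateBasis]

/-- The site translation as a permutation of the configurations. -/
def shift (q L : ℕ) : Config q L ≃ Config q L where
  toFun τ s := τ (s + 1)
  invFun τ s := τ (s - 1)
  left_inv τ := by simp
  right_inv τ := by simp

theorem shift_update (σ : Config q L) (s : ZMod (2 * L)) (i : Fin q) :
    shift q L (Function.update σ (s + 1) i) = Function.update (shift q L σ) s i := by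
  funext y
  by_cases h : y = s
  · simp [shift, h]
  · have h' : y + 1 ≠ s + 1 := fun h' => h (add_right_cancel h')
    simp [shift, h]

theorem shift_symm_update (σ : Config q L) (s : ZMod (2 * L)) (i : Fin q) :
    (shift q L).symm (Function.update σ s i) =
      Function.update ((shift q L).symm σ) (s + 1) i := by
  rw [Equiv.symm_apply_eq, shift_update, Equiv.apply_symm_apply]

theorem translation_eq : translation q L = (1 : ChainOp q L).submatrix id (shift q L) := by
  ext σ τ
  simp [translation, one_apply, shift]

theorem translation_conj (X : ChainOp q L) :
    (translation q L)ᴴ * X * translation q L = X.submatrix (shift q L) (shift q L) := by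
  ext σ τ
  simp [translation_eq, mul_apply, one_apply]

theorem translation_conj_symm (X : ChainOp q L) :
    translation q L * X * (translation q L)ᴴ =
      X.submatrix (shift q L).symm (shift q L).symm := by
  ext σ τ
  have h : ∀ x, shift q L x = τ ↔ x = (shift q L).symm τ := fun x =>
    (Equiv.eq_symm_apply _).symm
  simp [translation_eq, mul_apply, one_apply, ← Equiv.symm_apply_eq]
  simp [h]

theorem evenLayer_unitary {U : TwoBody q} (hU : U ∈ unitaryGroup (Fin q × Fin q) ℂ) :
    (evenLayer U L)ᴴ * evenLayer U L = 1 := by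
  have h : Uᴴ * U = 1 := mem_unitaryGroup_iff'.1 hU
  rw [evenLayer_eq, conjTranspose_submatrix, submatrix_mul_equiv, piTensor_conjTranspose,
    piTensor_mul]
  simp only [h, piTensor_one, submatrix_one_equiv]

theorem oddLayer_conj (U : TwoBody q) (X : ChainOp q L) :
    (oddLayer U L)ᴴ * X * oddLayer U L =
      ((evenLayer U L)ᴴ * X.submatrix (shift q L) (shift q L) * evenLayer U L).submatrix
        (shift q L).symm (shift q L).symm := by
  rw [← translation_conj, ← translation_conj_symm, oddLayer]
  simp only [conjTranspose_mul, conjTranspose_conjTranspose, mul_assoc]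

theorem oddLayer_unitary {U : TwoBody q} (hU : U ∈ unitaryGroup (Fin q × Fin q) ℂ) :
    (oddLayer U L)ᴴ * oddLayer U L = 1 := by
  have := oddLayer_conj U (1 : ChainOp q L)
  simpa [evenLayer_unitary hU] using this

/-- The layers of the brickwork in alternating order, starting with an even one at `k = 0`. -/
noncomputable def layer (U : TwoBody q) (L : ℕ) [NeZero L] (k : ℕ) : ChainOp q L :=
  if Even k then evenLayer U L else oddLayer U L

theorem layer_unitary {U : TwoBody q} (hU : U ∈ unitaryGroup (Fin q × Fin q) ℂ) (k : ℕ) :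
    (layer U L k)ᴴ * layer U L k = 1 := by
  rw [layer]
  split_ifs
  · exact evenLayer_unitary hU
  · exact oddLayer_unitary hU

/-- The Heisenberg evolution through the layer `k`. -/
noncomputable def step (U : TwoBody q) (k : ℕ) (X : ChainOp q L) : ChainOp q L :=
  (layer U L k)ᴴ * X * layer U L k

/-- The layer `k` acts separately on each of its gates, which sit on the pairs of sites
`(m, m + 1)` with `m ≡ k` mod 2. -/
theorem step_gate [NeZero q] {U : TwoBody q}
    {Wl Wr Wl' Wr' : Submodule ℂ (Matrix (Fin q) (Fin q) ℂ)}
    (hW : ∀ x ∈ pairSub Wl Wr, Uᴴ * x * U ∈ pairSub Wl' Wr') {k : ℕ} {m : ℤ}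
    (hm : (m - k) % 2 = 0) {X : ChainOp q L} (hl : LocIn Wl (m : ZMod (2 * L)) X)
    (hr : LocIn Wr ((m + 1 : ℤ) : ZMod (2 * L)) X) :
    LocIn Wl' (m : ZMod (2 * L)) (step U k X) ∧
      LocIn Wr' ((m + 1 : ℤ) : ZMod (2 * L)) (step U k X) := by
  -- An odd layer is the translate of an even one, so the even layers decide.
  have even : ∀ (m : ℤ) (X : ChainOp q L), LocIn Wl ((2 * m : ℤ) : ZMod (2 * L)) X →
      LocIn Wr ((2 * m + 1 : ℤ) : ZMod (2 * L)) X →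
      LocIn Wl' ((2 * m : ℤ) : ZMod (2 * L)) ((evenLayer U L)ᴴ * X * evenLayer U L) ∧
        LocIn Wr' ((2 * m + 1 : ℤ) : ZMod (2 * L)) ((evenLayer U L)ᴴ * X * evenLayer U L) := by
    intro m X hl hr
    obtain ⟨z, hz⟩ := exists_gate (L := L) m
    rw [Int.cast_add, Int.cast_one, hz] at hr ⊢
    rw [hz] at hl
    rw [← locIn_pairSub_iff, gateBasis_conj]
    exact ((locIn_pairSub_iff X z).2 ⟨hl, hr⟩).conj_piTensor hW
  rw [step, layer]
  split_ifs with hk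
  · obtain ⟨k, rfl⟩ := hk
    obtain ⟨n, rfl⟩ : ∃ n, m = 2 * n := ⟨m / 2, by omega⟩
    exact even n X hl hr
  · obtain ⟨k, rfl⟩ := Nat.not_even_iff_odd.1 hk
    obtain ⟨n, rfl⟩ : ∃ n, m = 2 * n - 1 := ⟨(m + 1) / 2, by omega⟩
    rw [oddLayer_conj]
    have e1 : ((2 * n : ℤ) : ZMod (2 * L)) = ((2 * n - 1 : ℤ) : ZMod (2 * L)) + 1 := by
      push_cast
      ring
    have e2 : ((2 * n + 1 : ℤ) : ZMod (2 * L)) = ((2 * n - 1 + 1 : ℤ) : ZMod (2 * L)) + 1 := by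
      push_cast
      ring
    have := even n (X.submatrix (shift q L) (shift q L))
      (hl.submatrix _ fun σ i => by rw [e1, shift_update])
      (hr.submatrix _ fun σ i => by rw [e2, shift_update])
    exact ⟨this.1.submatrix _ fun σ i => by rw [e1, shift_symm_update],
      this.2.submatrix _ fun σ i => by rw [e2, shift_symm_update]⟩

/-- An even layer conjugates the two-site block on `(0, 1)` by a unitary, which preserves its
trace. -/
theorem step_zero_jointlyTraceless [NeZero q] {U : TwoBody q}
    (hU : U ∈ unitaryGroup (Fin q × Fin q) ℂ) {X : ChainOp q L}
    (hX : JointlyTraceless (0 : ZMod (2 * L)) 1 X) :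
    JointlyTraceless (0 : ZMod (2 * L)) 1 (step U 0 X) := by
  have h0 : (2 * (((0 : Fin L) : ℕ) : ZMod (2 * L))) = 0 := by simp
  have key : ∀ Y : ChainOp q L, JointlyTraceless (0 : ZMod (2 * L)) 1 Y ↔
      LocIn (traceless (Fin q × Fin q)) (0 : Fin L) (gateBasis Y) := by
    intro Y
    have h : ∀ ρ ρ', (slice (0 : Fin L) (gateBasis Y) ρ ρ').trace =
        ∑ i, ∑ j, Y (Function.update (Function.update ((gateEquiv q L).symm ρ) 0 i) 1 j)
          (Function.update (Function.update ((gateEquiv q L).symm ρ') 0 i) 1 j) := by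
      intro ρ ρ'
      rw [trace, Fintype.sum_prod_type]
      simp only [diag_apply, slice_gateBasis, h0, zero_add]
    refine ⟨fun hY ρ ρ' => ?_, fun hY σ τ => ?_⟩
    · rw [mem_traceless, h]
      exact hY _ _
    · have := mem_traceless.1 (hY (gateEquiv q L σ) (gateEquiv q L τ))
      rwa [h, Equiv.symm_apply_apply, Equiv.symm_apply_apply] at this
  rw [key] at hX ⊢
  rw [step, layer, if_pos Even.zero, gateBasis_conj]
  exact hX.conj_piTensor fun x hx => conj_trace_eq_zero hU hx

end Layers

/-! ### Spreading of operators under the brickwork -/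

section Spreading

variable {q L : ℕ} [NeZero L] [NeZero q] {U : TwoBody q} {X : ChainOp q L}

/-- `X` is traceless at the sites `l` and `r`, and it acts trivially outside the arc from `l`
to `r`. The two sites are represented by integers, so that `l + 2 * L` is again the site `l`;
`l = r` is allowed. -/
structure Spread (X : ChainOp q L) (l r : ℤ) : Prop where
  left : LocIn (traceless (Fin q)) (l : ZMod (2 * L)) X
  right : LocIn (traceless (Fin q)) (r : ZMod (2 * L)) X
  triv : ∀ m : ℤ, r < m → m < l + 2 * L → LocIn (scalars (Fin q)) (m : ZMod (2 * L)) X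

theorem cast_add_period (m : ℤ) : ((m + 2 * L : ℤ) : ZMod (2 * L)) = m := by
  have : ((2 * L : ℕ) : ZMod (2 * L)) = 0 := ZMod.natCast_self _
  push_cast at this ⊢
  rw [this, add_zero]

/-- A layer does not create any support on the gates at which the operator is trivial. -/
theorem step_triv (hU : U ∈ unitaryGroup (Fin q × Fin q) ℂ) {k : ℕ} {A B : ℤ}
    (hA : (A - k) % 2 = 0) (hB : (B - k) % 2 = 0)
    (h : ∀ m, A ≤ m → m < B → LocIn (scalars (Fin q)) (m : ZMod (2 * L)) X) (m : ℤ) (hm : A ≤ m)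
    (hm' : m < B) : LocIn (scalars (Fin q)) (m : ZMod (2 * L)) (step U k X) := by
  rcases Int.emod_two_eq_zero_or_one (m - k) with hk | hk
  · exact (step_gate (fun x hx => conj_mem_scalars hU hx) hk (h m hm hm')
      (h _ (by omega) (by omega))).1
  · have := (step_gate (k := k) (m := m - 1) (fun x hx => conj_mem_scalars hU hx) (by omega)
      (h _ (by omega) (by omega)) (h _ (by omega) (by omega))).2
    rwa [sub_add_cancel] at this

/-- When gates straddle both ends of the arc, the arc grows by one site at each end, and the last
two sites at each end are traceless. -/
theorem Spread.step (hU : IsTwoUnitary U) {k : ℕ} {l r : ℤ} (hX : Spread X l r)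
    (hl : (l - 1 - k) % 2 = 0) (hr : (r - k) % 2 = 0) (hlr : r + 1 < l + 2 * L) :
    Spread (step U k X) (l - 1) (r + 1) ∧
      LocIn (traceless (Fin q)) (l : ZMod (2 * L)) (BernoulliCircuit.step U k X) ∧
      LocIn (traceless (Fin q)) (r : ZMod (2 * L)) (BernoulliCircuit.step U k X) := by
  have h1 := hX.triv (l - 1 + 2 * L) (by omega) (by omega)
  rw [cast_add_period] at h1
  have hL := step_gate (m := l - 1) (fun x hx => conj_mem_of_right hU hx) hl h1
    (by rw [sub_add_cancel]; exact hX.left)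
  have hR := step_gate (fun x hx => conj_mem_of_left hU hx) hr hX.right
    (hX.triv _ (by omega) hlr)
  rw [sub_add_cancel] at hL
  refine ⟨⟨hL.1, hR.2, fun m hm hm' => ?_⟩, hL.2, hR.1⟩
  exact step_triv hU.1.1 (A := r + 2) (B := l - 1 + 2 * L) (by omega) (by omega)
    (fun m hm hm' => hX.triv m (by omega) (by omega)) m (by omega) hm'

theorem Spread.step_left_leg (hU : IsTwoUnitary U) {k : ℕ} {s : ℤ} (hX : Spread X s s)
    (hs : (s - k) % 2 = 0) : Spread (BernoulliCircuit.step U k X) s (s + 1) := by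
  have h0 : 0 < L := Nat.pos_of_ne_zero (NeZero.ne L)
  have hR := step_gate (fun x hx => conj_mem_of_left hU hx) hs hX.right
    (hX.triv _ (by omega) (by omega))
  refine ⟨hR.1, hR.2, fun m hm hm' => ?_⟩
  exact step_triv hU.1.1 (A := s + 2) (B := s + 2 * L) (by omega) (by omega)
    (fun m hm hm' => hX.triv m (by omega) (by omega)) m (by omega) hm'

theorem Spread.step_right_leg (hU : IsTwoUnitary U) {k : ℕ} {s : ℤ} (hX : Spread X s s)
    (hs : (s - 1 - k) % 2 = 0) : Spread (BernoulliCircuit.step U k X) (s - 1) s := by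
  have h0 : 0 < L := Nat.pos_of_ne_zero (NeZero.ne L)
  have h1 := hX.triv (s - 1 + 2 * L) (by omega) (by omega)
  rw [cast_add_period] at h1
  have hL := step_gate (m := s - 1) (fun x hx => conj_mem_of_right hU hx) hs h1
    (by rw [sub_add_cancel]; exact hX.left)
  rw [sub_add_cancel] at hL
  refine ⟨hL.1, hL.2, fun m hm hm' => ?_⟩
  exact step_triv hU.1.1 (A := s + 1) (B := s - 1 + 2 * L) (by omega) (by omega)
    (fun m hm hm' => hX.triv m (by omega) (by omega)) m (by omega) hm'

/-- The Heisenberg evolution through the `n` layers `k`, `k + 1`, …, `k + n - 1`. -/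
noncomputable def heisenberg (U : TwoBody q) : ℕ → ℕ → ChainOp q L → ChainOp q L
  | _, 0, X => X
  | k, n + 1, X => heisenberg U (k + 1) n (BernoulliCircuit.step U k X)

theorem heisenberg_succ (k n : ℕ) (X : ChainOp q L) :
    heisenberg U k (n + 1) X = step U (k + n) (heisenberg U k n X) := by
  induction n generalizing k X with
  | zero => rfl
  | succ n ih =>
    rw [heisenberg, ih, heisenberg, add_right_comm, add_assoc]

theorem step_add (k : ℕ) (X Y : ChainOp q L) : step U k (X + Y) = step U k X + step U k Y := by
  simp only [step, mul_add, add_mul]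

theorem heisenberg_add (k n : ℕ) (X Y : ChainOp q L) :
    heisenberg U k n (X + Y) = heisenberg U k n X + heisenberg U k n Y := by
  induction n generalizing k X Y with
  | zero => rfl
  | succ n ih => simp only [heisenberg, step_add, ih]

/-- As long as the two light-cone edges have not met around the chain, an evolved operator is
traceless at three sites at least, hence at one avoiding any two given sites. -/
theorem Spread.exists_traceless (hU : IsTwoUnitary U) (n : ℕ) {k : ℕ} {l r : ℤ}
    (hX : Spread X l r) (hl : (l - 1 - k) % 2 = 0) (hr : (r - k) % 2 = 0) (hlr : l < r)
    (hn : r - l + 2 * n + 3 ≤ 2 * L) (x₁ x₂ : ZMod (2 * L)) :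
    ∃ y, y ≠ x₁ ∧ y ≠ x₂ ∧ LocIn (traceless (Fin q)) y (heisenberg U k (n + 1) X) := by
  have h := hX.step hU hl hr (by omega)
  induction n generalizing k l r X with
  | zero =>
    -- Two sites can exclude at most two of the three distinct sites `l - 1`, `l` and `r`.
    have h1 : ((l - 1 : ℤ) : ZMod (2 * L)) ≠ l := site_ne (by omega) (by omega)
    have h2 : ((l - 1 : ℤ) : ZMod (2 * L)) ≠ r := site_ne (by omega) (by omega)
    have h3 : (l : ZMod (2 * L)) ≠ r := site_ne (by omega) (by omega)
    have ha := h.1.left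
    have hb := h.2.1
    have hc := h.2.2
    generalize ((l - 1 : ℤ) : ZMod (2 * L)) = u at *
    generalize (l : ZMod (2 * L)) = v at *
    generalize (r : ZMod (2 * L)) = w at *
    simp only [heisenberg]
    by_cases hu : u ≠ x₁ ∧ u ≠ x₂
    · exact ⟨u, hu.1, hu.2, ha⟩
    by_cases hv : v ≠ x₁ ∧ v ≠ x₂
    · exact ⟨v, hv.1, hv.2, hb⟩
    refine ⟨w, ?_, ?_, hc⟩ <;> grind
  | succ n ih =>
    have h' := h.1
    exact ih h' (by push_cast; omega) (by push_cast; omega) (by omega) (by push_cast at hn; omega)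
      (h'.step hU (by push_cast; omega) (by push_cast; omega) (by push_cast at hn; omega))

variable {P : ZMod (2 * L) → Matrix (Fin q) (Fin q) ℂ} {x₁ x₂ : ZMod (2 * L)}

theorem trace_eq_zero_of_exists (hP : ∀ y, y ≠ x₁ → y ≠ x₂ → P y = 1)
    (h : ∃ y, y ≠ x₁ ∧ y ≠ x₂ ∧ LocIn (traceless (Fin q)) y X) : (piTensor P * X).trace = 0 := by
  obtain ⟨y, h1, h2, hy⟩ := h
  exact trace_piTensor_mul_eq_zero (hP y h1 h2) hy

/-- The three sectors of an operator that is supported on the sites `0` and `1` and has no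
component along the identity. -/
theorem exists_spread_decomposition
    (htriv : ∀ m : ℤ, 1 < m → m < 2 * L → LocIn (scalars (Fin q)) (m : ZMod (2 * L)) X)
    (hX : JointlyTraceless (0 : ZMod (2 * L)) 1 X) :
    ∃ Y Yl Yr, X = Y + Yl + Yr ∧ Spread Y 0 1 ∧ Spread Yl 0 0 ∧ Spread Yr 1 1 := by
  have h0 : 0 < L := Nat.pos_of_ne_zero (NeZero.ne L)
  have hne : (1 : ZMod (2 * L)) ≠ 0 := by
    have := site_ne (L := L) (m := 0) (n := 1) (by omega) (by omega)
    simpa using this.symm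
  obtain ⟨Y, Yl, Yr, hsum, hY, hl, hr, h⟩ := hX.exists_decomposition hne
  have h' : ∀ m : ℤ, 1 < m → m < 2 * L → LocIn (scalars (Fin q)) (m : ZMod (2 * L)) Y ∧
      LocIn (scalars (Fin q)) (m : ZMod (2 * L)) Yl ∧
      LocIn (scalars (Fin q)) (m : ZMod (2 * L)) Yr := by
    intro m hm hm'
    refine h m ?_ ?_ (htriv m hm hm')
    · simpa using (site_ne (L := L) (m := 0) (n := m) (by omega) (by omega)).symm
    · simpa using (site_ne (L := L) (m := 1) (n := m) (by omega) (by omega)).symm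
  refine ⟨Y, Yl, Yr, hsum, ⟨by simpa using hY.1, by simpa using hY.2, fun m hm hm' => ?_⟩,
    ⟨by simpa using hl.1, by simpa using hl.1, fun m hm hm' => ?_⟩,
    ⟨by simpa using hr.2, by simpa using hr.2, fun m hm hm' => ?_⟩⟩
  · exact (h' m hm (by omega)).1
  · rcases eq_or_lt_of_le (show 1 ≤ m by omega) with rfl | hm1
    · simpa using hl.2
    · exact (h' m hm1 (by omega)).2.1
  -- The arc of `Yr` starts at the site `1`; its complement contains the site `2 * L`, that is `0`.
  · rcases eq_or_lt_of_le (show m ≤ 2 * L by omega) with rfl | hm1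
    · have := cast_add_period (L := L) 0
      rw [zero_add] at this
      rw [this]
      simpa using hr.1
    · exact (h' m hm hm1).2.2

/-- After an odd layer and at least one more layer, an operator that started on the sites `0`
and `1` without identity component has no overlap with products of two one-site operators. -/
theorem trace_heisenberg_eq_zero (hU : IsTwoUnitary U)
    (htriv : ∀ m : ℤ, 1 < m → m < 2 * L → LocIn (scalars (Fin q)) (m : ZMod (2 * L)) X)
    (hX : JointlyTraceless (0 : ZMod (2 * L)) 1 X)
    (hP : ∀ y, y ≠ x₁ → y ≠ x₂ → P y = 1) {n : ℕ} (hn : 2 ≤ n) (hnL : n + 1 ≤ L) :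
    (piTensor P * heisenberg U 1 n X).trace = 0 := by
  obtain ⟨Y, Yl, Yr, rfl, hY, hl, hr⟩ := exists_spread_decomposition htriv hX
  obtain ⟨n, rfl⟩ : ∃ m, n = m + 1 + 1 := ⟨n - 2, by omega⟩
  have h := trace_eq_zero_of_exists hP (hY.exists_traceless hU (n + 1) (k := 1) (by norm_num)
    (by norm_num) (by norm_num) (by push_cast; omega) x₁ x₂)
  have hl' : (piTensor P * heisenberg U 1 (n + 1 + 1) Yl).trace = 0 :=
    trace_eq_zero_of_exists hP ((hl.step_right_leg hU (k := 1)
    (by norm_num)).exists_traceless hU n (k := 2) (by norm_num) (by norm_num) (by norm_num)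
    (by omega) x₁ x₂)
  have hr' : (piTensor P * heisenberg U 1 (n + 1 + 1) Yr).trace = 0 :=
    trace_eq_zero_of_exists hP ((hr.step_left_leg hU (k := 1)
    (by norm_num)).exists_traceless hU n (k := 2) (by norm_num) (by norm_num) (by norm_num)
    (by omega) x₁ x₂)
  rw [heisenberg_add, heisenberg_add, mul_add, mul_add, trace_add, trace_add, h, hl', hr',
    add_zero, add_zero]

theorem exists_ne_of_pair_ne {α : Type*} {u v x₁ x₂ : α} (huv : u ≠ v)
    (h : ({x₁, x₂} : Set α) ≠ {u, v}) : (u ≠ x₁ ∧ u ≠ x₂) ∨ (v ≠ x₁ ∧ v ≠ x₂) := by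
  by_contra hc
  apply h
  ext y
  simp only [Set.mem_insert_iff, Set.mem_singleton_iff]
  grind

/-- After a single odd layer, only the sectors that started on one leg can contribute, and only
at the two legs of the gate that they have met. -/
theorem trace_step_one_eq_zero (hU : IsTwoUnitary U)
    (htriv : ∀ m : ℤ, 1 < m → m < 2 * L → LocIn (scalars (Fin q)) (m : ZMod (2 * L)) X)
    (hX : JointlyTraceless (0 : ZMod (2 * L)) 1 X)
    (hP : ∀ y, y ≠ x₁ → y ≠ x₂ → P y = 1) (hL : 2 ≤ L)
    (h1 : ({x₁, x₂} : Set (ZMod (2 * L))) ≠ {1, 2})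
    (h2 : ({x₁, x₂} : Set (ZMod (2 * L))) ≠ {-1, 0}) :
    (piTensor P * step U 1 X).trace = 0 := by
  obtain ⟨Y, Yl, Yr, rfl, hY, hl, hr⟩ := exists_spread_decomposition htriv hX
  have edge : ∀ (Z : ChainOp q L) (m m' : ℤ), m < m' → m' < m + 2 * L →
      ({x₁, x₂} : Set (ZMod (2 * L))) ≠ {(m : ZMod (2 * L)), (m' : ZMod (2 * L))} →
      Spread Z m m' → (piTensor P * Z).trace = 0 := by
    intro Z m m' h h' hne hZ
    refine trace_eq_zero_of_exists hP ?_
    rcases exists_ne_of_pair_ne (site_ne (L := L) h h') hne with hy | hy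
    · exact ⟨_, hy.1, hy.2, hZ.left⟩
    · exact ⟨_, hy.1, hy.2, hZ.right⟩
  have h : (piTensor P * step U 1 Y).trace = 0 :=
    trace_eq_zero_of_exists hP (hY.exists_traceless hU 0 (k := 1) (by norm_num) (by norm_num)
      (by norm_num) (by push_cast; omega) x₁ x₂)
  rw [step_add, step_add, mul_add, mul_add, trace_add, trace_add, h,
    edge _ _ _ (by norm_num) (by omega) (by simpa using h2)
      (hl.step_right_leg hU (k := 1) (by norm_num)),
    edge _ _ _ (by norm_num) (by omega) (by simpa [one_add_one_eq_two] using h1)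
      (hr.step_left_leg hU (k := 1) (by norm_num)), add_zero, add_zero]

end Spreading

/-! ### Correlation functions -/

section Correlations

variable {q L : ℕ} [NeZero L] {U : TwoBody q}

/-- `siteOp x a` is the tensor product of `a` at `x` and the identity elsewhere. -/
theorem siteOp_eq (x : ZMod (2 * L)) (a : Matrix (Fin q) (Fin q) ℂ) :
    siteOp x a = piTensor (Function.update (fun _ => 1) x a) := by
  ext σ τ
  rw [siteOp, piTensor, of_apply, of_apply, ← Finset.mul_prod_erase _ _ (Finset.mem_univ x),
    Function.update_self]
  have : ∀ z ∈ Finset.univ.erase x, Function.update (fun _ => (1 : Matrix (Fin q) (Fin q) ℂ)) x a z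
      (σ z) (τ z) = if σ z = τ z then 1 else 0 := fun z hz => by
    rw [Function.update_of_ne (Finset.ne_of_mem_erase hz), one_apply]
  rw [Finset.prod_congr rfl this, Finset.prod_ite_zero]
  simp

theorem conj_eq_heisenberg_brickwork [NeZero q] (n : ℕ) (X : ChainOp q L) :
    (brickwork U L n)ᴴ * X * brickwork U L n = heisenberg U 0 n X := by
  induction n with
  | zero => simp [brickwork, heisenberg]
  | succ n ih =>
    rw [heisenberg_succ, ← ih, zero_add, step, layer, brickwork]
    simp only [conjTranspose_mul, mul_assoc]

theorem conj_eq_heisenberg_floquet_pow [NeZero q] (t : ℕ) (X : ChainOp q L) :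
    (floquet U L ^ t)ᴴ * X * floquet U L ^ t = heisenberg U 1 (2 * t) X := by
  induction t with
  | zero => simp [heisenberg]
  | succ t ih =>
    have h1 : ¬ Even (1 + 2 * t) := by simp [parity_simps]
    have h2 : Even (1 + (2 * t + 1)) := by simp [parity_simps]
    rw [mul_add_one, heisenberg_succ, heisenberg_succ, ← ih, step, step, layer, layer, if_neg h1,
      if_pos h2, pow_succ, floquet]
    simp only [conjTranspose_mul, mul_assoc]

theorem heisenberg_one [NeZero q] (hU : U ∈ unitaryGroup (Fin q × Fin q) ℂ) (k n : ℕ) :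
    heisenberg U k n (1 : ChainOp q L) = 1 := by
  induction n with
  | zero => rfl
  | succ n ih => rw [heisenberg_succ, ih, step, mul_one, layer_unitary hU]

/-- The correlations as overlaps of the observable at time zero with the Heisenberg evolution of
the other one. -/
theorem corr_eq [NeZero q] (hU : U ∈ unitaryGroup (Fin q × Fin q) ℂ) {V : ChainOp q L} {k n : ℕ}
    (hV : ∀ X, Vᴴ * X * V = heisenberg U k n X) (a b c d : Matrix (Fin q) (Fin q) ℂ)
    (x₁ x₂ : ZMod (2 * L)) : corr V a b c d x₁ x₂ = 1 / (q : ℂ) ^ (2 * L) *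
      ((siteOp x₁ c * siteOp x₂ d) * heisenberg U k n (siteOp 0 a * siteOp 1 b)).trace := by
  have h : Vᴴ * V = 1 := by simpa [heisenberg_one hU] using hV 1
  rw [corr, inv_eq_left_inv h, ← hV]
  simp only [mul_assoc]

end Correlations

end BernoulliCircuit

theorem mainTheorem10 {q L : ℕ} [NeZero L] (U : BernoulliCircuit.TwoBody q)
    (hU : BernoulliCircuit.IsTwoUnitary U)
    (a b c d : Matrix (Fin q) (Fin q) ℂ) (hab : a.trace = 0 ∨ b.trace = 0)
    (x₁ x₂ : ZMod (2 * L)) :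
    (∀ t : ℕ, 0 < t → 2 * t < L →
      BernoulliCircuit.corr (BernoulliCircuit.floquet U L ^ t) a b c d x₁ x₂ = 0) ∧
    (∀ n : ℕ, 3 ≤ n → n ≤ L →
      BernoulliCircuit.corr (BernoulliCircuit.brickwork U L n) a b c d x₁ x₂ = 0) ∧
    (2 ≤ L → ({x₁, x₂} : Set (ZMod (2 * L))) ≠ {1, 2} →
      ({x₁, x₂} : Set (ZMod (2 * L))) ≠ {-1, 0} →
      BernoulliCircuit.corr (BernoulliCircuit.brickwork U L 2) a b c d x₁ x₂ = 0) := by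
  open BernoulliCircuit in
  have h0 : 0 < L := Nat.pos_of_ne_zero (NeZero.ne L)
  rcases Nat.eq_zero_or_pos q with rfl | hq
  · -- There are no configurations, so every trace is an empty sum.
    have : ∀ V : ChainOp 0 L, corr V a b c d x₁ x₂ = 0 := fun V => by
      rw [corr, trace, Finset.univ_eq_empty, Finset.sum_empty, mul_zero]
    exact ⟨fun _ _ _ => this _, fun _ _ _ => this _, fun _ _ _ => this _⟩
  have : NeZero q := ⟨hq.ne'⟩
  obtain ⟨P, hP, hcd⟩ : ∃ P : ZMod (2 * L) → Matrix (Fin q) (Fin q) ℂ,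
      (∀ y, y ≠ x₁ → y ≠ x₂ → P y = 1) ∧ siteOp x₁ c * siteOp x₂ d = piTensor P := by
    refine ⟨_, fun y h1 h2 => ?_, by rw [siteOp_eq, siteOp_eq, piTensor_mul]⟩
    simp [h1, h2]
  have hne : (0 : ZMod (2 * L)) ≠ 1 := by
    simpa using site_ne (L := L) (m := 0) (n := 1) (by omega) (by omega)
  obtain ⟨X, hXab, hX, htriv⟩ : ∃ X : ChainOp q L, siteOp 0 a * siteOp 1 b = X ∧
      JointlyTraceless (0 : ZMod (2 * L)) 1 X ∧
      ∀ m : ℤ, 2 ≤ m → m < 2 * L → LocIn (scalars (Fin q)) (m : ZMod (2 * L)) X := by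
    refine ⟨_, by rw [siteOp_eq, siteOp_eq, piTensor_mul], ?_, fun m hm hm' => ?_⟩
    · rcases hab with h | h
      · refine .of_left hne (.piTensor (mem_traceless.2 ?_))
        simpa [hne] using h
      · refine .of_right (.piTensor (mem_traceless.2 ?_))
        simpa [hne.symm] using h
    · have hm0 : (m : ZMod (2 * L)) ≠ 0 := by
        simpa using (site_ne (L := L) (m := 0) (n := m) (by omega) (by omega)).symm
      have hm1 : (m : ZMod (2 * L)) ≠ 1 := by
        simpa using (site_ne (L := L) (m := 1) (n := m) (by omega) (by omega)).symm
      refine .piTensor (mem_scalars.2 ⟨1, ?_⟩)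
      simp [hm0, hm1]
  -- The first layer of the brickwork acts inside the gate on the sites `0` and `1`.
  have hX' := step_zero_jointlyTraceless hU.1.1 hX
  have htriv' := step_triv hU.1.1 (k := 0) (A := 2) (B := 2 * L) (by norm_num)
    (by norm_num) htriv
  refine ⟨fun t ht htL => ?_, fun n hn hnL => ?_, fun hL h1 h2 => ?_⟩
  · rw [corr_eq hU.1.1 (conj_eq_heisenberg_floquet_pow t), hcd, hXab,
      trace_heisenberg_eq_zero hU htriv hX hP (by omega) (by omega), mul_zero]
  · obtain ⟨n, rfl⟩ : ∃ m, n = m + 1 := ⟨n - 1, by omega⟩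
    rw [corr_eq hU.1.1 (conj_eq_heisenberg_brickwork _), hcd, hXab, heisenberg,
      trace_heisenberg_eq_zero hU htriv' hX' hP (by omega) (by omega), mul_zero]
  · rw [corr_eq hU.1.1 (conj_eq_heisenberg_brickwork _), hcd, hXab, heisenberg, heisenberg,
      heisenberg, trace_step_one_eq_zero hU htriv' hX' hP hL h1 h2, mul_zero]
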